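/- Let $d\ge 1$ be an integer and let $\mathbb{T}^d=\mathbb{R}^d/\mathbb{Z}^d$ carry its Haar probability measure (Lebesgue measure on $[0,1)^d$). For $f\in\ell^2(\mathbb{Z}^d)$ let $\mathcal{F}f(\xi)=\sum_{n\in\mathbb{Z}^d}f(n)e^{2\pi i n\cdot\xi}$ (convergence in $L^2(\mathbb{T}^d)$) be its Fourier transform. For a measurable function $m$ on $\mathbb{T}^d$, let $T_m$ be the Fourier multiplier operator $\mathcal{F}(T_mf)=m\,\mathcal{F}f$, that is, $$T_mf(n)=\int_{(0,1)^d}m(\xi)\,\mathcal{F}f(\xi)\,e^{-2\pi i n\cdot\xi}\,d\xi,\qquad n\in\mathbb{Z}^d,$$ whenever $m\,\mathcal{F}f\in L^1(\mathbb{T}^d)$. Let $0<r<d$ and suppose that for some constant $c$ we have $|m(\xi)|\le c\,|\xi|^{-r}$ for all $\xi\in(0,1)^d$, where $|\cdot|$ is the Euclidean norm. Let $1<p\le 2\le q<\infty$ with $$\frac1p-\frac1q=\frac rd .$$ Then $m\,\mathcal{F}f\in L^1(\mathbb{T}^d)$ for every $f\in\ell^p(\mathbb{Z}^d)$ (note that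 $\ell^p(\mathbb{Z}^d)\subset\ell^2(\mathbb{Z}^d)$), and $T_m$ is a bounded linear operator from $\ell^p(\mathbb{Z}^d)$ to $\ell^q(\mathbb{Z}^d)$. -/

import Mathlib

open MeasureTheory
open scoped ENNReal

noncomputable section

/-- `ℓ^p(ℤ^d)`: the complex-valued `p`-summable functions on `ℤ^d`. -/
abbrev LatticeLp (d : ℕ) (p : ℝ≥0∞) : Type := lp (fun _ : Fin d → ℤ => ℂ) p

/-- The Haar probability measure on `𝕋^d = ℝ^d / ℤ^d`, i.e. Lebesgue measure on `[0,1)^d`. -/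
abbrev torusMeasure (d : ℕ) : Measure (UnitAddTorus (Fin d)) :=
  Measure.pi fun _ => AddCircle.haarAddCircle

/-- The Fourier transform `ℓ²(ℤ^d) → L²(𝕋^d)`, `f ↦ ∑ₙ f(n) e^{2πi n·ξ}` (convergence in `L²`);
it is the isometry attached to the orthonormal basis of exponentials `ξ ↦ e^{2πi n·ξ}`. -/
def latticeFourier {d : ℕ} (f : LatticeLp d 2) : Lp ℂ 2 (torusMeasure d) :=
  UnitAddTorus.mFourierBasis.repr.symm f

/-- The multiplier transformation `T_m f = 𝓕⁻¹ (m · 𝓕 f)`, that is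
`T_m f (n) = ∫_{𝕋^d} m(ξ) 𝓕f(ξ) e^{-2πi n·ξ} dξ`.
The integral is meaningful when `m · 𝓕 f` is integrable. -/
def fourierMultiplier {d : ℕ} (m : UnitAddTorus (Fin d) → ℂ) (f : LatticeLp d 2) :
    (Fin d → ℤ) → ℂ :=
  UnitAddTorus.mFourierCoeff fun ξ => m ξ * latticeFourier f ξ

/-- For `p ≤ 2`, an element of `ℓ^p(ℤ^d)` regarded as an element of `ℓ²(ℤ^d)`. -/
def LatticeLp.toTwo {d : ℕ} {p : ℝ≥0∞} (hp : p ≤ 2) (f : LatticeLp d p) : LatticeLp d 2 :=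
  ⟨f, (lp.memℓp f).of_exponent_ge hp⟩

end

/-! The operator is bounded by duality and a weighted `L²` inequality. Let `p'` be the conjugate
exponent of `q`; then `1 < p' ≤ 2` and `r = d(1/p + 1/p' - 1)` is the average of `d(2/p - 1)` and
`d(2/p' - 1)`. Pairing `T_m f` with `g` gives at most a constant times `∫ |ξ|^(-r) |𝓕f| |𝓕g|`, and
Cauchy–Schwarz reduces this to `∫ |ξ|^(-d(2/p-1)) |𝓕f|² ≤ C ‖f‖_p²` for `1 < p ≤ 2`, used once for
`(f, p)` and once for `(g, p')`.

For `p < 2` and `‖f‖_p ≤ 1`, the weight is dominated by a dyadic sum over cubes of side `2^(-k)`. On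
the `k`-th cube `f` is cut at height `2^(-kd/p)`: the large part is estimated through `ℓ¹ → L^∞` and
the volume of the cube, the small part through Plancherel. Exchanging the sums over `k` and `n`
leaves, for each `n`, two geometric series comparable to their largest terms, each contributing
`O(|f n|^p)`. -/

open MeasureTheory
open scoped ENNReal

noncomputable section

/-! ### Sup norm and cubes on the torus -/

/-- The representative in `(0, 1]` of a point of `ℝ / ℤ`. -/
def circleRep (x : UnitAddCircle) : ℝ := AddCircle.equivIoc 1 0 x

theorem circleRep_mem (x : UnitAddCircle) : circleRep x ∈ Set.Ioc (0 : ℝ) 1 := by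
  have h : circleRep x ∈ Set.Ioc (0 : ℝ) (0 + 1) := (AddCircle.equivIoc (1 : ℝ) 0 x).2
  rwa [zero_add] at h

theorem coe_circleRep (x : UnitAddCircle) : (circleRep x : UnitAddCircle) = x :=
  AddCircle.coe_equivIoc ..

theorem measurable_circleRep : Measurable circleRep :=
  measurable_subtype_coe.comp (AddCircle.measurableEquivIoc 1 0).measurable

theorem haarAddCircle_eq_volume :
    (AddCircle.haarAddCircle : Measure UnitAddCircle) = volume := by
  rw [AddCircle.volume_eq_smul_haarAddCircle]
  simp

theorem measurePreserving_circleRep :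
    MeasurePreserving circleRep AddCircle.haarAddCircle (volume.restrict (Set.Ioc (0 : ℝ) 1)) := by
  have h : MeasurePreserving circleRep volume (volume.restrict (Set.Ioc (0 : ℝ) (0 + 1))) :=
    (measurePreserving_subtype_coe measurableSet_Ioc).comp
    (AddCircle.measurePreserving_equivIoc (1 : ℝ) (a := 0))
  rw [zero_add, ← haarAddCircle_eq_volume] at h
  exact h

theorem haarAddCircle_circleRep_le {t : ℝ} (ht : t ≤ 1) :
    AddCircle.haarAddCircle {x | circleRep x ≤ t} = ENNReal.ofReal t := by
  refine (measurePreserving_circleRep.measure_preimage (s := Set.Iic t)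
    measurableSet_Iic.nullMeasurableSet).trans ?_
  rw [Measure.restrict_apply measurableSet_Iic]
  have : Set.Iic t ∩ Set.Ioc (0 : ℝ) 1 = Set.Ioc 0 t := by
    ext x
    simp only [Set.mem_inter_iff, Set.mem_Iic, Set.mem_Ioc]
    constructor
    · rintro ⟨a, b, c⟩
      exact ⟨b, a⟩
    · rintro ⟨a, b⟩
      exact ⟨b, a, by linarith⟩
  rw [this]
  simp

theorem ae_circleRep_lt_one : ∀ᵐ x ∂(AddCircle.haarAddCircle : Measure UnitAddCircle),
    circleRep x < 1 := by
  refine measurePreserving_circleRep.quasiMeasurePreserving.ae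
    (p := fun y : ℝ => y < 1) ((ae_restrict_iff' measurableSet_Ioc).2 ?_)
  filter_upwards [(measure_eq_zero_iff_ae_notMem (μ := (volume : Measure ℝ))).1
    (measure_singleton 1)] with x hx hx1
  exact lt_of_le_of_ne hx1.2 hx

/-- The sup norm of the representative in `(0, 1]^d` of a point of `𝕋^d`. -/
def torusSup {d : ℕ} (ξ : UnitAddTorus (Fin d)) : ℝ := ‖fun i => circleRep (ξ i)‖

theorem measurable_torusSup {d : ℕ} : Measurable (torusSup (d := d)) :=
  measurable_norm.comp (measurable_pi_lambda _ fun i => measurable_circleRep.comp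
    (measurable_pi_apply i))

theorem torusSup_le_iff {d : ℕ} {ξ : UnitAddTorus (Fin d)} {t : ℝ} (ht : 0 ≤ t) :
    torusSup ξ ≤ t ↔ ∀ i, circleRep (ξ i) ≤ t := by
  rw [torusSup, pi_norm_le_iff_of_nonneg ht]
  refine forall_congr' fun i => ?_
  rw [Real.norm_of_nonneg (circleRep_mem _).1.le]

theorem torusSup_le_one {d : ℕ} (ξ : UnitAddTorus (Fin d)) : torusSup ξ ≤ 1 :=
  (torusSup_le_iff zero_le_one).2 fun i => (circleRep_mem (ξ i)).2

/-- Representatives are taken in `(0, 1]`, so even the identity of the torus has positive sup norm,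
and negative powers never meet zero. -/
theorem torusSup_pos {d : ℕ} (hd : 0 < d) (ξ : UnitAddTorus (Fin d)) : 0 < torusSup ξ := by
  refine lt_of_lt_of_le (circleRep_mem (ξ ⟨0, hd⟩)).1 ?_
  refine (le_abs_self _).trans ?_
  exact norm_le_pi_norm (fun i => circleRep (ξ i)) ⟨0, hd⟩

theorem torusMeasure_torusSup_le {d : ℕ} {t : ℝ} (ht0 : 0 ≤ t) (ht : t ≤ 1) :
    torusMeasure d {ξ | torusSup ξ ≤ t} = ENNReal.ofReal t ^ d := by
  have : {ξ : UnitAddTorus (Fin d) | torusSup ξ ≤ t} =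
      Set.univ.pi fun _ => {x | circleRep x ≤ t} := by
    ext ξ
    simp [torusSup_le_iff ht0]
  rw [this, torusMeasure, Measure.pi_pi]
  simp [haarAddCircle_circleRep_le ht]

theorem ae_norm_le_torusSup_rpow {d : ℕ} {r c : ℝ} (hr0 : 0 < r) (hrd : r < d)
    {m : UnitAddTorus (Fin d) → ℂ}
    (hmc : ∀ ξ : EuclideanSpace ℝ (Fin d), (∀ i, ξ i ∈ Set.Ioo (0 : ℝ) 1) → ξ ≠ 0 →
      ‖m (fun i => (ξ i : UnitAddCircle))‖ ≤ c * ‖ξ‖ ^ (-r)) :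
    ∀ᵐ ξ ∂torusMeasure d, ‖m ξ‖ ≤ |c| * torusSup ξ ^ (-r) := by
  have hd : 0 < d := by exact_mod_cast hr0.trans hrd
  -- The bound on `m` concerns the open cube only; points with a coordinate represented by `1` form
  -- a null set.
  have h1 : ∀ᵐ ξ ∂torusMeasure d, ∀ i, circleRep (ξ i) < 1 :=
    ae_all_iff.2 fun i => (Measure.tendsto_eval_ae_ae (i := i)
      (μ := fun _ : Fin d => AddCircle.haarAddCircle)).eventually ae_circleRep_lt_one
  filter_upwards [h1] with ξ hξ
  set x : EuclideanSpace ℝ (Fin d) := WithLp.toLp 2 fun i => circleRep (ξ i) with hx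
  have hsup : torusSup ξ ≤ ‖x‖ := by
    refine (pi_norm_le_iff_of_nonneg (norm_nonneg _)).2 fun i => ?_
    exact PiLp.norm_apply_le x i
  have hpos : 0 < ‖x‖ := (torusSup_pos hd ξ).trans_le hsup
  have h2 := hmc x (fun i => ⟨(circleRep_mem (ξ i)).1, hξ i⟩) (norm_pos_iff.1 hpos)
  have h3 : (fun i => (x i : UnitAddCircle)) = ξ := funext fun i => coe_circleRep (ξ i)
  rw [h3] at h2
  refine h2.trans (mul_le_mul (le_abs_self c) ?_ (by positivity) (abs_nonneg c))
  exact Real.rpow_le_rpow_of_nonpos (torusSup_pos hd ξ) hsup (by linarith)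

/-- Dyadic bound of a negative power of the sup norm by indicators of cubes. -/
theorem torusSup_rpow_neg_le_tsum {d : ℕ} (hd : 0 < d) {β : ℝ} (hβ : 0 ≤ β)
    (ξ : UnitAddTorus (Fin d)) :
    ENNReal.ofReal (torusSup ξ) ^ (-β) ≤ 2 ^ β * ∑' k : ℕ, ((2 : ℝ≥0∞) ^ β) ^ k *
      {ξ : UnitAddTorus (Fin d) | torusSup ξ ≤ (2⁻¹ : ℝ) ^ k}.indicator 1 ξ := by
  -- With `2^(-(k+1)) < torusSup ξ ≤ 2^(-k)`, the `k`-th term alone suffices; the factor `2 ^ β`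
  -- pays for the gap between the two powers.
  obtain ⟨k, hk1, hk2⟩ := exists_nat_pow_near_of_lt_one (torusSup_pos hd ξ) (torusSup_le_one ξ)
    (by norm_num : (0 : ℝ) < 2⁻¹) (by norm_num)
  refine le_trans ?_ (mul_le_mul_right (ENNReal.le_tsum k) _)
  rw [Set.indicator_of_mem (by exact hk2), Pi.one_apply, mul_one, ← pow_succ',
    ← ENNReal.rpow_natCast, ← ENNReal.rpow_mul, mul_comm β, ENNReal.rpow_mul, ENNReal.rpow_natCast,
    ENNReal.rpow_neg, ← ENNReal.inv_rpow]
  refine ENNReal.rpow_le_rpow ?_ hβ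
  rw [ENNReal.inv_le_iff_inv_le, ENNReal.inv_pow]
  have : (2 : ℝ≥0∞)⁻¹ ^ (k + 1) = ENNReal.ofReal ((2⁻¹ : ℝ) ^ (k + 1)) := by
    rw [ENNReal.ofReal_pow (by norm_num), ENNReal.ofReal_inv_of_pos (by norm_num)]
    simp
  rw [this]
  exact ENNReal.ofReal_le_ofReal hk1.le

/-! ### Plancherel and finitely supported sequences -/

theorem lp_tsum_enorm_rpow {ι : Type*} {p : ℝ≥0∞} [Fact (1 ≤ p)] (hp : 0 < p.toReal)
    (f : lp (fun _ : ι => ℂ) p) : ∑' n, ‖f n‖ₑ ^ p.toReal = ‖f‖ₑ ^ p.toReal := by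
  rw [← ofReal_norm f, ENNReal.ofReal_rpow_of_nonneg (norm_nonneg _) hp.le,
    lp.norm_rpow_eq_tsum hp, ENNReal.ofReal_tsum_of_nonneg (fun n => by positivity)
      ((lp.memℓp f).summable hp)]
  refine tsum_congr fun n => ?_
  rw [← ofReal_norm, ENNReal.ofReal_rpow_of_nonneg (norm_nonneg _) hp.le]

variable {d : ℕ}

theorem latticeFourier_add (f g : LatticeLp d 2) :
    latticeFourier (f + g) = latticeFourier f + latticeFourier g := map_add _ f g

theorem latticeFourier_smul (a : ℂ) (f : LatticeLp d 2) :
    latticeFourier (a • f) = a • latticeFourier f :=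
  map_smul UnitAddTorus.mFourierBasis.repr.symm a f

theorem latticeFourier_zero : latticeFourier (0 : LatticeLp d 2) = 0 :=
  map_zero UnitAddTorus.mFourierBasis.repr.symm

theorem norm_latticeFourier (f : LatticeLp d 2) : ‖latticeFourier f‖ = ‖f‖ :=
  UnitAddTorus.mFourierBasis.repr.symm.norm_map f

/-- Plancherel's identity. -/
theorem lintegral_enorm_latticeFourier_sq (f : LatticeLp d 2) :
    ∫⁻ ξ, ‖latticeFourier f ξ‖ₑ ^ 2 ∂torusMeasure d = ∑' n, ‖f n‖ₑ ^ 2 := by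
  have h := lp_tsum_enorm_rpow (by norm_num) f
  have h2 : ‖f‖ₑ = eLpNorm (latticeFourier f) 2 (torusMeasure d) := by
    rw [← Lp.enorm_def, ← ofReal_norm, ← ofReal_norm, norm_latticeFourier]
  rw [h2, eLpNorm_eq_lintegral_rpow_enorm_toReal (by norm_num) (by norm_num),
    ← ENNReal.rpow_mul] at h
  simpa using h.symm

/-- The element of `ℓ²(ℤ^d)` equal to `g` on the finite set `S` and zero elsewhere. -/
def latticeFinite (S : Finset (Fin d → ℤ)) (g : (Fin d → ℤ) → ℂ) : LatticeLp d 2 :=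
  ∑ n ∈ S, lp.single 2 n (g n)

open Classical in
theorem latticeFinite_apply (S : Finset (Fin d → ℤ)) (g : (Fin d → ℤ) → ℂ) (n : Fin d → ℤ) :
    latticeFinite S g n = if n ∈ S then g n else 0 := by
  rw [latticeFinite, lp.coeFn_sum, Finset.sum_apply]
  simp [lp.single_apply, Pi.single_apply]

theorem latticeFourier_latticeFinite (S : Finset (Fin d → ℤ)) (g : (Fin d → ℤ) → ℂ) :
    latticeFourier (latticeFinite S g) =ᵐ[torusMeasure d]
      fun ξ => ∑ n ∈ S, g n * UnitAddTorus.mFourier n ξ := by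
  classical
  induction S using Finset.induction_on with
  | empty =>
    simp only [latticeFinite, Finset.sum_empty, latticeFourier_zero]
    exact Lp.coeFn_zero _ _ _
  | insert k S hk ih =>
    have h1 : latticeFinite (insert k S) g = g k • lp.single 2 k (1 : ℂ) + latticeFinite S g := by
      rw [latticeFinite, Finset.sum_insert hk, latticeFinite, ← lp.single_smul, smul_eq_mul, mul_one]
    have h2 : latticeFourier (lp.single 2 k (1 : ℂ)) = UnitAddTorus.mFourierLp (d := Fin d) 2 k := by
      rw [latticeFourier, HilbertBasis.repr_symm_single, UnitAddTorus.coe_mFourierBasis]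
    rw [h1, latticeFourier_add, latticeFourier_smul, h2]
    filter_upwards [ih, Lp.coeFn_add (g k • UnitAddTorus.mFourierLp (d := Fin d) 2 k)
      (latticeFourier (latticeFinite S g)),
      Lp.coeFn_smul (g k) (UnitAddTorus.mFourierLp (d := Fin d) 2 k),
      UnitAddTorus.coeFn_mFourierLp (d := Fin d) 2 k] with ξ a b c e
    rw [Finset.sum_insert hk, b, Pi.add_apply, c, a, Pi.smul_apply, e, smul_eq_mul]

/-- The `ℓ¹ → L^∞` endpoint: characters have modulus one. -/
theorem ae_enorm_latticeFourier_latticeFinite_le (S : Finset (Fin d → ℤ))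
    (g : (Fin d → ℤ) → ℂ) : ∀ᵐ ξ ∂torusMeasure d,
      ‖latticeFourier (latticeFinite S g) ξ‖ₑ ≤ ∑ n ∈ S, ‖g n‖ₑ := by
  filter_upwards [latticeFourier_latticeFinite S g] with ξ h
  rw [h]
  refine (enorm_sum_le _ _).trans (Finset.sum_le_sum fun n _ => ?_)
  rw [enorm_mul]
  refine mul_le_of_le_one_right' ?_
  rw [← ofReal_norm, ← ENNReal.ofReal_one]
  refine ENNReal.ofReal_le_ofReal ?_
  exact ((UnitAddTorus.mFourier n).norm_coe_le_norm ξ).trans UnitAddTorus.mFourier_norm.le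

theorem ENNReal.add_sq_le_two_mul (a b : ℝ≥0∞) : (a + b) ^ 2 ≤ 2 * a ^ 2 + 2 * b ^ 2 := by
  have h := ENNReal.rpow_add_le_mul_rpow_add_rpow a b (p := 2) (by norm_num)
  norm_num at h
  rwa [mul_add] at h

open Classical in
/-- On a set `E`, the mass of `𝓕 f` is controlled by the `ℓ¹` norm of `f` on `S`
and its `ℓ²` norm off `S`. -/
theorem setLIntegral_latticeFourier_sq_le (f : LatticeLp d 2) (S : Finset (Fin d → ℤ))
    (E : Set (UnitAddTorus (Fin d))) :
    ∫⁻ ξ in E, ‖latticeFourier f ξ‖ₑ ^ 2 ∂torusMeasure d ≤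
      2 * (torusMeasure d E * (∑ n ∈ S, ‖f n‖ₑ) ^ 2) +
        2 * ∑' n, if n ∈ S then 0 else ‖f n‖ₑ ^ 2 := by
  have hf : f = latticeFinite S f + (f - latticeFinite S f) := by abel
  have hae : ∀ᵐ ξ ∂torusMeasure d, ‖latticeFourier f ξ‖ₑ ^ 2 ≤
      2 * (∑ n ∈ S, ‖f n‖ₑ) ^ 2 + 2 * ‖latticeFourier (f - latticeFinite S f) ξ‖ₑ ^ 2 := by
    filter_upwards [ae_enorm_latticeFourier_latticeFinite_le S f,
      Lp.coeFn_add (latticeFourier (latticeFinite S f)) (latticeFourier (f - latticeFinite S f))]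
      with ξ h1 h2
    rw [← latticeFourier_add, ← hf] at h2
    rw [h2, Pi.add_apply]
    refine (pow_le_pow_left' (enorm_add_le _ _) 2).trans ((ENNReal.add_sq_le_two_mul _ _).trans ?_)
    gcongr
  have hrest : ∫⁻ ξ, ‖latticeFourier (f - latticeFinite S f) ξ‖ₑ ^ 2 ∂torusMeasure d =
      ∑' n, if n ∈ S then 0 else ‖f n‖ₑ ^ 2 := by
    rw [lintegral_enorm_latticeFourier_sq]
    refine tsum_congr fun n => ?_
    rw [lp.coeFn_sub, Pi.sub_apply, latticeFinite_apply]
    split_ifs <;> simp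
  calc ∫⁻ ξ in E, ‖latticeFourier f ξ‖ₑ ^ 2 ∂torusMeasure d
      ≤ ∫⁻ ξ in E, (2 * (∑ n ∈ S, ‖f n‖ₑ) ^ 2 +
          2 * ‖latticeFourier (f - latticeFinite S f) ξ‖ₑ ^ 2) ∂torusMeasure d :=
        lintegral_mono_ae (ae_restrict_of_ae hae)
    _ = 2 * (∑ n ∈ S, ‖f n‖ₑ) ^ 2 * torusMeasure d E +
          2 * ∫⁻ ξ in E, ‖latticeFourier (f - latticeFinite S f) ξ‖ₑ ^ 2 ∂torusMeasure d := by
        rw [lintegral_add_left measurable_const, setLIntegral_const,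
          lintegral_const_mul' _ _ (by norm_num)]
    _ ≤ _ := by
        rw [mul_assoc, mul_comm (_ ^ 2), ← hrest]
        gcongr
        exact Measure.restrict_le_self

/-! ### Truncated geometric series -/

/-- All terms before the first `K` with `y ^ K < x` vanish, and the rest is dominated by a geometric
series with leading term at most `x ^ θ`. If `y ≥ 1` the constant is `∞`. -/
theorem ENNReal.tsum_pow_rpow_lt_le {y x : ℝ≥0∞} {θ : ℝ} (hθ : 0 < θ) :
    ∑' k : ℕ, (if y ^ k < x then (y ^ k) ^ θ else 0) ≤ (1 - y ^ θ)⁻¹ * x ^ θ := by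
  classical
  by_cases h : ∃ k, y ^ k < x
  · have hk := Nat.find_spec h
    set K := Nat.find h with hK
    have hterm : ∀ k, (y ^ k) ^ θ = (y ^ θ) ^ k := fun k => by
      rw [← ENNReal.rpow_natCast, ← ENNReal.rpow_natCast, ← ENNReal.rpow_mul, ← ENNReal.rpow_mul,
        mul_comm]
    rw [← Summable.sum_add_tsum_nat_add' (k := K) ENNReal.summable, Finset.sum_eq_zero, zero_add]
    · calc ∑' k : ℕ, (if y ^ (k + K) < x then (y ^ (k + K)) ^ θ else 0)
          ≤ ∑' k : ℕ, (y ^ θ) ^ k * (y ^ K) ^ θ := by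
            refine ENNReal.tsum_le_tsum fun k => ?_
            split_ifs
            · rw [hterm, hterm, pow_add]
            · exact zero_le
        _ ≤ _ := by
            rw [ENNReal.tsum_mul_right, ENNReal.tsum_geometric]
            gcongr
    · intro k hk'
      rw [if_neg (Nat.find_min h (Finset.mem_range.1 hk'))]
  · push Not at h
    simp [not_lt.2 (h _)]

/-- The nonzero terms are those before the first `K` with `y ^ K < x`. Read backwards from `K - 1`,
they decay geometrically from a value at most `(x ^ θ)⁻¹`. -/
theorem ENNReal.tsum_pow_rpow_inv_le_le {y x : ℝ≥0∞} (hy : y < 1) (hx0 : x ≠ 0)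
    {θ : ℝ} (hθ : 0 < θ) :
    ∑' k : ℕ, (if x ≤ y ^ k then ((y ^ k) ^ θ)⁻¹ else 0) ≤ (1 - y ^ θ)⁻¹ * (x ^ θ)⁻¹ := by
  classical
  have h : ∃ k, y ^ k < x :=
    ((ENNReal.tendsto_pow_atTop_nhds_zero_of_lt_one hy).eventually
      (gt_mem_nhds (pos_iff_ne_zero.2 hx0))).exists
  have hmin := fun k hk => not_lt.1 (Nat.find_min h (m := k) hk)
  have hK := Nat.find_spec h
  set K := Nat.find h with hKdef
  have hytop : y ≠ ∞ := (hy.trans ENNReal.one_lt_top).ne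
  have hsum : ∑' k : ℕ, (if x ≤ y ^ k then ((y ^ k) ^ θ)⁻¹ else 0) =
      ∑ k ∈ Finset.range K, ((y ^ k) ^ θ)⁻¹ := by
    rw [tsum_eq_sum (s := Finset.range K)]
    · exact Finset.sum_congr rfl fun k hk => if_pos (hmin k (Finset.mem_range.1 hk))
    · intro k hk
      rw [if_neg]
      rw [Finset.mem_range, not_lt] at hk
      exact not_le.2 ((pow_le_pow_right_of_le_one' hy.le hk).trans_lt hK)
  rw [hsum, ← Finset.sum_range_reflect, ← ENNReal.tsum_geometric, ← ENNReal.tsum_mul_right]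
  refine le_trans (Finset.sum_le_sum fun j hj => ?_) (ENNReal.sum_le_tsum (Finset.range K))
  have hj' := Finset.mem_range.1 hj
  have h1 : x ≤ y ^ (K - 1 - j) * y ^ j := by
    rw [← pow_add]
    have := hmin (K - 1) (by omega)
    rwa [show K - 1 - j + j = K - 1 by omega]
  have h2 : x ^ θ ≤ (y ^ (K - 1 - j)) ^ θ * (y ^ θ) ^ j := by
    refine (ENNReal.rpow_le_rpow h1 hθ.le).trans (le_of_eq ?_)
    rw [ENNReal.mul_rpow_of_nonneg _ _ hθ.le]
    congr 1
    rw [← ENNReal.rpow_natCast, ← ENNReal.rpow_natCast, ← ENNReal.rpow_mul, ← ENNReal.rpow_mul,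
      mul_comm]
  have hxθ : x ^ θ ≠ 0 := by simp [hx0, not_lt.2 hθ.le]
  have hxθt : x ^ θ ≠ ∞ := by
    refine ne_top_of_le_ne_top ?_ h2
    exact ENNReal.mul_ne_top (ENNReal.rpow_ne_top_of_nonneg hθ.le (ENNReal.pow_ne_top hytop))
      (ENNReal.pow_ne_top (ENNReal.rpow_ne_top_of_nonneg hθ.le hytop))
  rw [← div_eq_mul_inv, ENNReal.le_div_iff_mul_le (Or.inl hxθ) (Or.inl hxθt), mul_comm,
    ← div_eq_mul_inv]
  refine ENNReal.div_le_of_le_mul ?_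
  rwa [mul_comm]

/-! ### The weighted Fourier inequality -/

theorem lintegral_torusSup_rpow_neg_mul_le (hd : 0 < d) {β : ℝ} (hβ : 0 ≤ β)
    {g : UnitAddTorus (Fin d) → ℝ≥0∞} (hg : AEMeasurable g (torusMeasure d)) :
    ∫⁻ ξ, ENNReal.ofReal (torusSup ξ) ^ (-β) * g ξ ∂torusMeasure d ≤
      2 ^ β * ∑' k : ℕ, ((2 : ℝ≥0∞) ^ β) ^ k *
        ∫⁻ ξ in {ξ | torusSup ξ ≤ (2⁻¹ : ℝ) ^ k}, g ξ ∂torusMeasure d := by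
  have hmeas : ∀ k : ℕ, MeasurableSet {ξ : UnitAddTorus (Fin d) | torusSup ξ ≤ (2⁻¹ : ℝ) ^ k} :=
    fun k => measurable_torusSup measurableSet_Iic
  calc _ ≤ ∫⁻ ξ, 2 ^ β * ∑' k : ℕ, ((2 : ℝ≥0∞) ^ β) ^ k *
        {ξ : UnitAddTorus (Fin d) | torusSup ξ ≤ (2⁻¹ : ℝ) ^ k}.indicator g ξ ∂torusMeasure d := by
        refine lintegral_mono fun ξ => ?_
        refine (mul_le_mul_left (torusSup_rpow_neg_le_tsum hd hβ ξ) _).trans (le_of_eq ?_)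
        rw [mul_assoc, ← ENNReal.tsum_mul_right]
        congr 1
        refine tsum_congr fun k => ?_
        rw [mul_assoc]
        congr 1
        by_cases h : torusSup ξ ≤ (2⁻¹ : ℝ) ^ k
        · rw [Set.indicator_of_mem (by exact h), Set.indicator_of_mem (by exact h), Pi.one_apply,
            one_mul]
        · rw [Set.indicator_of_notMem (by exact h), Set.indicator_of_notMem (by exact h), zero_mul]
    _ = _ := by
        have h2 : (2 : ℝ≥0∞) ^ β ≠ ∞ := ENNReal.rpow_ne_top_of_nonneg hβ (by norm_num)
        rw [lintegral_const_mul' _ _ h2, lintegral_tsum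
          fun k => (hg.indicator (hmeas k)).const_mul _]
        congr 1
        refine tsum_congr fun k => ?_
        rw [lintegral_const_mul' _ _ (ENNReal.pow_ne_top h2), lintegral_indicator (hmeas k)]

open Classical in
/-- Mass of `𝓕 f` on a set `E`, split at the level `t` of `|f|`. -/
theorem setLIntegral_latticeFourier_sq_le_level (f : LatticeLp d 2) {p : ℝ} (hp1 : 1 < p)
    (hf : ∑' n, ‖f n‖ₑ ^ p ≤ 1) (E : Set (UnitAddTorus (Fin d))) {t : ℝ≥0∞} (ht : t ≠ 0)
    (htt : t ≠ ∞) :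
    ∫⁻ ξ in E, ‖latticeFourier f ξ‖ₑ ^ 2 ∂torusMeasure d ≤
      2 * (torusMeasure d E * ((t ^ (p - 1))⁻¹ * ∑' n, if t < ‖f n‖ₑ then ‖f n‖ₑ else 0)) +
        2 * ∑' n, if ‖f n‖ₑ ≤ t then ‖f n‖ₑ ^ 2 else 0 := by
  have hp0 : 0 < p := by linarith
  have hfin : {n | t < ‖f n‖ₑ}.Finite := by
    refine (ENNReal.finite_const_le_of_tsum_ne_top (hf.trans_lt ENNReal.one_lt_top).ne
      (ε := t ^ p) (by simp [ht, htt])).subset fun n hn => ?_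
    exact ENNReal.rpow_le_rpow (le_of_lt hn) hp0.le
  have hmem : ∀ n, n ∈ hfin.toFinset ↔ t < ‖f n‖ₑ := fun n => by simp
  have hsum : ∑ n ∈ hfin.toFinset, ‖f n‖ₑ = ∑' n, if t < ‖f n‖ₑ then ‖f n‖ₑ else 0 := by
    rw [tsum_eq_sum (s := hfin.toFinset)]
    · exact Finset.sum_congr rfl fun n hn => (if_pos ((hmem n).1 hn)).symm
    · exact fun n hn => if_neg fun h => hn ((hmem n).2 h)
  -- Chebyshev: above the level `t`, `‖f n‖ₑ ≤ t^(-(p-1)) ‖f n‖ₑ ^ p`.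
  have hbound : ∑ n ∈ hfin.toFinset, ‖f n‖ₑ ≤ (t ^ (p - 1))⁻¹ := by
    calc ∑ n ∈ hfin.toFinset, ‖f n‖ₑ
        ≤ ∑ n ∈ hfin.toFinset, (t ^ (p - 1))⁻¹ * ‖f n‖ₑ ^ p := by
          refine Finset.sum_le_sum fun n hn => ?_
          have hn' := (hmem n).1 hn
          have h0 : t ^ (p - 1) ≠ 0 := by simp [ht, htt]
          have h1 : t ^ (p - 1) ≠ ∞ := ENNReal.rpow_ne_top_of_nonneg (by linarith) htt
          rw [mul_comm, ← div_eq_mul_inv, ENNReal.le_div_iff_mul_le (Or.inl h0) (Or.inl h1)]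
          have h2 : ‖f n‖ₑ ^ p = ‖f n‖ₑ * ‖f n‖ₑ ^ (p - 1) := by
            conv_rhs => rw [← ENNReal.rpow_one ‖f n‖ₑ, ← ENNReal.rpow_mul, one_mul,
              ← ENNReal.rpow_add 1 (p - 1) (pos_of_gt hn').ne' enorm_ne_top]
            ring_nf
          rw [h2]
          gcongr
      _ = (t ^ (p - 1))⁻¹ * ∑ n ∈ hfin.toFinset, ‖f n‖ₑ ^ p := by rw [Finset.mul_sum]
      _ ≤ (t ^ (p - 1))⁻¹ * 1 := by
          gcongr
          exact (ENNReal.sum_le_tsum _).trans hf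
      _ = _ := mul_one _
  refine (setLIntegral_latticeFourier_sq_le f hfin.toFinset E).trans ?_
  refine add_le_add ?_ (le_of_eq ?_)
  -- Only one factor of the square is replaced by its bound; the other remains a sum over `n`, to be
  -- exchanged later with the sum over `k`.
  · rw [sq, ← hsum]
    gcongr
  · congr 1
    refine tsum_congr fun n => ?_
    by_cases h : t < ‖f n‖ₑ
    · rw [if_pos ((hmem n).2 h), if_neg (not_le.2 h)]
    · rw [if_neg (fun h' => h ((hmem n).1 h')), if_pos (not_lt.1 h)]

theorem lintegral_torusSup_rpow_latticeFourier_le_of_lt (hd : 0 < d) {p : ℝ} (hp1 : 1 < p)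
    (hp2 : p < 2) : ∃ C : ℝ≥0∞, C ≠ ∞ ∧ ∀ f : LatticeLp d 2, ∑' n, ‖f n‖ₑ ^ p ≤ 1 →
      ∫⁻ ξ, ENNReal.ofReal (torusSup ξ) ^ (-(d * (2 / p - 1))) * ‖latticeFourier f ξ‖ₑ ^ 2
        ∂torusMeasure d ≤ C := by
  classical
  have hp0 : 0 < p := by linarith
  have hd' : (0 : ℝ) < d := by exact_mod_cast hd
  set β : ℝ := d * (2 / p - 1) with hβdef
  have hβ : 0 ≤ β := mul_nonneg hd'.le (by rw [sub_nonneg, le_div_iff₀ hp0]; linarith)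
  -- The level `t = y ^ k` is chosen so that the `k`-th cube has measure `t ^ p` and the dyadic
  -- weight `2 ^ (β k)` equals `t ^ (-(2 - p))`.
  set y : ℝ≥0∞ := 2 ^ (-(d / p) : ℝ) with hydef
  have hy0 : y ≠ 0 := by simp [hydef]
  have hy1 : y < 1 := by
    rw [hydef]
    refine ENNReal.rpow_lt_one_of_one_lt_of_neg (by norm_num) ?_
    have : 0 < d / p := by positivity
    linarith
  have hyt : y ≠ ∞ := (hy1.trans ENNReal.one_lt_top).ne
  have hθ1 : 0 < p - 1 := by linarith
  have hθ2 : 0 < 2 - p := by linarith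
  have hpow : ∀ (k : ℕ) (θ : ℝ), (y ^ k) ^ θ = 2 ^ (-(d / p) * k * θ) := fun k θ => by
    rw [hydef, ← ENNReal.rpow_natCast, ← ENNReal.rpow_mul, ← ENNReal.rpow_mul, mul_assoc]
  have hβk : ∀ k : ℕ, ((2 : ℝ≥0∞) ^ β) ^ k = ((y ^ k) ^ (2 - p))⁻¹ := fun k => by
    rw [hpow, ← ENNReal.rpow_neg, ← ENNReal.rpow_natCast, ← ENNReal.rpow_mul]
    congr 1
    rw [hβdef]
    field_simp
  have hμk : ∀ k : ℕ, ((2 : ℝ≥0∞) ^ β) ^ k *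
      (torusMeasure d {ξ | torusSup ξ ≤ (2⁻¹ : ℝ) ^ k} * ((y ^ k) ^ (p - 1))⁻¹) =
      (y ^ k) ^ (p - 1) := fun k => by
    rw [torusMeasure_torusSup_le (by positivity) (pow_le_one₀ (by norm_num) (by norm_num)), hpow,
      ← ENNReal.rpow_neg, ← ENNReal.rpow_natCast, ← ENNReal.rpow_mul]
    have : ENNReal.ofReal ((2⁻¹ : ℝ) ^ k) ^ d = 2 ^ (-(k * d : ℝ)) := by
      rw [ENNReal.ofReal_pow (by norm_num), ENNReal.ofReal_inv_of_pos (by norm_num), ← pow_mul,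
        ENNReal.rpow_neg, ← Nat.cast_mul, ENNReal.rpow_natCast, ENNReal.inv_pow]
      simp
    rw [this, ← ENNReal.rpow_add _ _ (by norm_num) (by norm_num),
      ← ENNReal.rpow_add _ _ (by norm_num) (by norm_num)]
    congr 1
    rw [hβdef]
    field_simp
    ring
  -- Used with `θ = p - 1` and `θ = 2 - p`; the second degenerates at `p = 2`, which is therefore
  -- excluded here.
  have hC : ∀ θ : ℝ, 0 < θ → (1 - y ^ θ)⁻¹ ≠ ∞ := fun θ hθ => by
    rw [ENNReal.inv_ne_top]
    exact (tsub_pos_of_lt (ENNReal.rpow_lt_one hy1 hθ)).ne'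
  refine ⟨2 ^ β * (2 * (1 - y ^ (p - 1))⁻¹ + 2 * (1 - y ^ (2 - p))⁻¹), ?_, fun f hf => ?_⟩
  · refine ENNReal.mul_ne_top (ENNReal.rpow_ne_top_of_nonneg hβ (by norm_num)) ?_
    exact ENNReal.add_ne_top.2 ⟨ENNReal.mul_ne_top (by norm_num) (hC _ hθ1),
      ENNReal.mul_ne_top (by norm_num) (hC _ hθ2)⟩
  refine (lintegral_torusSup_rpow_neg_mul_le hd hβ ?_).trans ?_
  · exact (Lp.aestronglyMeasurable _).enorm.pow_const 2
  gcongr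
  have hrpow : ∀ x : ℝ≥0∞, x ≠ ∞ → x * x ^ (p - 1) = x ^ p := fun x hx => by
    rcases eq_or_ne x 0 with rfl | hx0
    · simp [hp0]
    conv_lhs => rw [← ENNReal.rpow_one x, ← ENNReal.rpow_mul, one_mul,
      ← ENNReal.rpow_add 1 (p - 1) hx0 hx]
    ring_nf
  have hrpow2 : ∀ x : ℝ≥0∞, x ≠ 0 → x ≠ ∞ → x ^ 2 * (x ^ (2 - p))⁻¹ = x ^ p := fun x hx0 hx => by
    rw [← ENNReal.rpow_natCast, ← ENNReal.rpow_neg, ← ENNReal.rpow_add _ _ hx0 hx]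
    congr 1
    push_cast
    ring
  calc ∑' k : ℕ, ((2 : ℝ≥0∞) ^ β) ^ k * ∫⁻ ξ in {ξ | torusSup ξ ≤ (2⁻¹ : ℝ) ^ k},
        ‖latticeFourier f ξ‖ₑ ^ 2 ∂torusMeasure d
      ≤ ∑' k : ℕ, (2 * ∑' n, (‖f n‖ₑ * if y ^ k < ‖f n‖ₑ then (y ^ k) ^ (p - 1) else 0) +
          2 * ∑' n, (‖f n‖ₑ ^ 2 * if ‖f n‖ₑ ≤ y ^ k then ((y ^ k) ^ (2 - p))⁻¹ else 0)) := by
        refine ENNReal.tsum_le_tsum fun k => ?_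
        refine (mul_le_mul_right (setLIntegral_latticeFourier_sq_le_level f hp1 hf _
          (pow_ne_zero k hy0) (ENNReal.pow_ne_top hyt)) _).trans (le_of_eq ?_)
        rw [mul_add]
        congr 1
        · rw [mul_left_comm, ← mul_assoc (torusMeasure d _), ← mul_assoc (_ ^ k), hμk,
            ← ENNReal.tsum_mul_left]
          congr 1
          refine tsum_congr fun n => ?_
          split_ifs
          · exact mul_comm _ _
          · simp
        · rw [mul_left_comm, hβk, ← ENNReal.tsum_mul_left]
          congr 1
          refine tsum_congr fun n => ?_
          split_ifs
          · exact mul_comm _ _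
          · simp
    _ = 2 * ∑' n, ‖f n‖ₑ * ∑' k : ℕ, (if y ^ k < ‖f n‖ₑ then (y ^ k) ^ (p - 1) else 0) +
          2 * ∑' n, ‖f n‖ₑ ^ 2 *
            ∑' k : ℕ, (if ‖f n‖ₑ ≤ y ^ k then ((y ^ k) ^ (2 - p))⁻¹ else 0) := by
        rw [ENNReal.tsum_add, ENNReal.tsum_mul_left, ENNReal.tsum_mul_left, ENNReal.tsum_comm]
        congr 2
        · exact tsum_congr fun n => ENNReal.tsum_mul_left
        · rw [ENNReal.tsum_comm]
          exact tsum_congr fun n => ENNReal.tsum_mul_left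
    _ ≤ 2 * ∑' n, (1 - y ^ (p - 1))⁻¹ * ‖f n‖ₑ ^ p +
          2 * ∑' n, (1 - y ^ (2 - p))⁻¹ * ‖f n‖ₑ ^ p := by
        refine add_le_add (mul_le_mul_right (ENNReal.tsum_le_tsum fun n => ?_) _)
          (mul_le_mul_right (ENNReal.tsum_le_tsum fun n => ?_) _)
        · refine (mul_le_mul_right (ENNReal.tsum_pow_rpow_lt_le hθ1) _).trans (le_of_eq ?_)
          rw [mul_left_comm, hrpow _ enorm_ne_top]
        -- When `f n = 0` the series over `k` is not truncated, but its factor `‖f n‖ₑ ^ 2`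
        -- vanishes.
        · rcases eq_or_ne ‖f n‖ₑ 0 with h0 | h0
          · rw [h0]
            simp
          refine (mul_le_mul_right (ENNReal.tsum_pow_rpow_inv_le_le hy1 h0 hθ2) _).trans
            (le_of_eq ?_)
          rw [mul_left_comm, hrpow2 _ h0 enorm_ne_top]
    _ ≤ 2 * ((1 - y ^ (p - 1))⁻¹ * 1) + 2 * ((1 - y ^ (2 - p))⁻¹ * 1) := by
        rw [ENNReal.tsum_mul_left, ENNReal.tsum_mul_left]
        gcongr
    _ = _ := by rw [mul_one, mul_one]

/-- Weighted Fourier inequality `ℓ^p(ℤ^d) → L²(|ξ|^{-d(2/p-1)} dξ)` for `1 < p ≤ 2`. -/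
theorem lintegral_torusSup_rpow_latticeFourier_le (hd : 0 < d) {p : ℝ} (hp1 : 1 < p)
    (hp2 : p ≤ 2) : ∃ C : ℝ≥0∞, C ≠ ∞ ∧ ∀ (f : LatticeLp d 2) (A : ℝ), 0 ≤ A →
      ∑' n, ‖f n‖ₑ ^ p ≤ ENNReal.ofReal A ^ p →
      ∫⁻ ξ, ENNReal.ofReal (torusSup ξ) ^ (-(d * (2 / p - 1))) * ‖latticeFourier f ξ‖ₑ ^ 2
        ∂torusMeasure d ≤ C * ENNReal.ofReal A ^ 2 := by
  have hp0 : 0 < p := by linarith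
  obtain ⟨C, hC, hCf⟩ : ∃ C : ℝ≥0∞, C ≠ ∞ ∧ ∀ f : LatticeLp d 2, ∑' n, ‖f n‖ₑ ^ p ≤ 1 →
      ∫⁻ ξ, ENNReal.ofReal (torusSup ξ) ^ (-(d * (2 / p - 1))) * ‖latticeFourier f ξ‖ₑ ^ 2
        ∂torusMeasure d ≤ C := by
    rcases hp2.lt_or_eq with h | rfl
    · exact lintegral_torusSup_rpow_latticeFourier_le_of_lt hd hp1 h
    -- At `p = 2` the weight has exponent `0` and the claim is Plancherel.
    · refine ⟨1, by norm_num, fun f hf => ?_⟩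
      simpa [lintegral_enorm_latticeFourier_sq] using hf
  refine ⟨C, hC, fun f A hA hf => ?_⟩
  rcases hA.eq_or_lt with rfl | hA
  · have hf0 : f = 0 := by
      ext n
      simp only [ENNReal.ofReal_zero, ENNReal.zero_rpow_of_pos hp0, nonpos_iff_eq_zero,
        ENNReal.tsum_eq_zero] at hf
      simpa [hp0, not_lt.2 hp0.le] using hf n
    have h0 : ∀ᵐ ξ ∂torusMeasure d, ENNReal.ofReal (torusSup ξ) ^ (-(d * (2 / p - 1))) *
        ‖latticeFourier f ξ‖ₑ ^ 2 = 0 := by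
      rw [hf0, latticeFourier_zero]
      filter_upwards [Lp.coeFn_zero ℂ 2 (torusMeasure d)] with ξ hξ
      rw [hξ]
      simp
    rw [lintegral_congr_ae h0]
    simp
  have hA0 : ENNReal.ofReal A ≠ 0 := by simpa using hA
  -- Rescaling by `A⁻¹` reduces to the normalised case by homogeneity.
  set a : ℂ := (A : ℂ)⁻¹ with ha
  have hae : ‖a‖ₑ = (ENNReal.ofReal A)⁻¹ := by
    rw [ha, enorm_inv (by exact_mod_cast hA.ne'), ← ofReal_norm, Complex.norm_real,
      Real.norm_of_nonneg hA.le]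
  have h1 := hCf (a • f) (by
    have : ∀ n, ‖(a • f) n‖ₑ ^ p = (ENNReal.ofReal A ^ p)⁻¹ * ‖f n‖ₑ ^ p := fun n => by
      rw [lp.coeFn_smul, Pi.smul_apply, enorm_smul, hae, ENNReal.mul_rpow_of_nonneg _ _ hp0.le,
        ENNReal.inv_rpow]
    simp_rw [this]
    rw [ENNReal.tsum_mul_left, mul_comm, ← div_eq_mul_inv]
    exact ENNReal.div_le_of_le_mul (by rwa [one_mul]))
  have h2 : ∀ᵐ ξ ∂torusMeasure d, ENNReal.ofReal (torusSup ξ) ^ (-(d * (2 / p - 1))) *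
      ‖latticeFourier f ξ‖ₑ ^ 2 = ENNReal.ofReal A ^ 2 *
        (ENNReal.ofReal (torusSup ξ) ^ (-(d * (2 / p - 1))) *
          ‖latticeFourier (a • f) ξ‖ₑ ^ 2) := by
    rw [latticeFourier_smul]
    filter_upwards [Lp.coeFn_smul a (latticeFourier f)] with ξ hξ
    rw [hξ, Pi.smul_apply, enorm_smul, hae, mul_pow, mul_left_comm, ← mul_assoc (_ ^ 2),
      ← mul_pow, ENNReal.mul_inv_cancel hA0 ENNReal.ofReal_ne_top, one_pow, one_mul]
  rw [lintegral_congr_ae h2, lintegral_const_mul' _ _ (by finiteness), mul_comm]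
  gcongr

/-! ### Bilinear estimate and duality -/

/-- Cauchy–Schwarz, after splitting the weight into the square roots of the weights attached to `p`
and `p'`. -/
theorem lintegral_torusSup_rpow_latticeFourier_mul_le (hd : 0 < d) {p p' r : ℝ} (hp1 : 1 < p)
    (hp2 : p ≤ 2) (hp1' : 1 < p') (hp2' : p' ≤ 2) (hr : r = d * (1 / p + 1 / p' - 1)) :
    ∃ C : ℝ≥0∞, C ≠ ∞ ∧ ∀ (f g : LatticeLp d 2) (A B : ℝ), 0 ≤ A → 0 ≤ B →
      ∑' n, ‖f n‖ₑ ^ p ≤ ENNReal.ofReal A ^ p → ∑' n, ‖g n‖ₑ ^ p' ≤ ENNReal.ofReal B ^ p' →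
      ∫⁻ ξ, ENNReal.ofReal (torusSup ξ) ^ (-r) * ‖latticeFourier f ξ‖ₑ * ‖latticeFourier g ξ‖ₑ
        ∂torusMeasure d ≤ C * ENNReal.ofReal A * ENNReal.ofReal B := by
  obtain ⟨C₁, hC₁, h₁⟩ := lintegral_torusSup_rpow_latticeFourier_le hd hp1 hp2
  obtain ⟨C₂, hC₂, h₂⟩ := lintegral_torusSup_rpow_latticeFourier_le hd hp1' hp2'
  refine ⟨C₁ ^ (1 / 2 : ℝ) * C₂ ^ (1 / 2 : ℝ), ENNReal.mul_ne_top
    (ENNReal.rpow_ne_top_of_nonneg (by norm_num) hC₁)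
    (ENNReal.rpow_ne_top_of_nonneg (by norm_num) hC₂), fun f g A B hA hB hf hg => ?_⟩
  have hsqrt : ∀ x y : ℝ≥0∞, (x * y ^ 2) ^ (1 / 2 : ℝ) = x ^ (1 / 2 : ℝ) * y := fun x y => by
    rw [ENNReal.mul_rpow_of_nonneg _ _ (by norm_num), ← ENNReal.rpow_natCast, ← ENNReal.rpow_mul]
    norm_num
  have hsq : ∀ (ξ : UnitAddTorus (Fin d)) (β : ℝ) (y : ℝ≥0∞),
      (ENNReal.ofReal (torusSup ξ) ^ (-β / 2) * y) ^ (2 : ℝ) =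
        ENNReal.ofReal (torusSup ξ) ^ (-β) * y ^ 2 := fun ξ β y => by
    rw [ENNReal.mul_rpow_of_nonneg _ _ (by norm_num), ← ENNReal.rpow_mul, ENNReal.rpow_two]
    norm_num
  have hmeas : ∀ (β : ℝ) (f : LatticeLp d 2), AEMeasurable (fun ξ =>
      ENNReal.ofReal (torusSup ξ) ^ (-β / 2) * ‖latticeFourier f ξ‖ₑ) (torusMeasure d) :=
    fun β f => ((measurable_torusSup.ennreal_ofReal.pow_const _).aemeasurable).mul
      (Lp.aestronglyMeasurable _).enorm
  have hmul : ∀ ξ : UnitAddTorus (Fin d), ENNReal.ofReal (torusSup ξ) ^ (-r) =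
      ENNReal.ofReal (torusSup ξ) ^ (-(d * (2 / p - 1)) / 2) *
        ENNReal.ofReal (torusSup ξ) ^ (-(d * (2 / p' - 1)) / 2) := fun ξ => by
    rw [← ENNReal.rpow_add _ _ (by simpa using torusSup_pos hd ξ) ENNReal.ofReal_ne_top, hr]
    congr 1
    ring
  have key := ENNReal.lintegral_mul_le_Lp_mul_Lq (torusMeasure d) Real.HolderConjugate.two_two
    (hmeas (d * (2 / p - 1)) f) (hmeas (d * (2 / p' - 1)) g)
  simp only [hsq, Pi.mul_apply] at key
  calc _ = ∫⁻ ξ, ENNReal.ofReal (torusSup ξ) ^ (-(d * (2 / p - 1)) / 2) * ‖latticeFourier f ξ‖ₑ *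
        (ENNReal.ofReal (torusSup ξ) ^ (-(d * (2 / p' - 1)) / 2) * ‖latticeFourier g ξ‖ₑ)
        ∂torusMeasure d := by
        refine lintegral_congr fun ξ => ?_
        rw [hmul]
        ring
    _ ≤ _ := key
    _ ≤ (C₁ * ENNReal.ofReal A ^ 2) ^ (1 / 2 : ℝ) * (C₂ * ENNReal.ofReal B ^ 2) ^ (1 / 2 : ℝ) := by
        gcongr
        · exact h₁ f A hA hf
        · exact h₂ g B hB hg
    _ = _ := by
        rw [hsqrt, hsqrt]
        ring

theorem tsum_enorm_latticeFinite_rpow (S : Finset (Fin d → ℤ)) (g : (Fin d → ℤ) → ℂ) {p : ℝ}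
    (hp : 0 < p) : ∑' n, ‖latticeFinite S g n‖ₑ ^ p = ∑ n ∈ S, ‖g n‖ₑ ^ p := by
  classical
  rw [tsum_eq_sum (s := S)]
  · exact Finset.sum_congr rfl fun n hn => by rw [latticeFinite_apply, if_pos hn]
  · intro n hn
    rw [latticeFinite_apply, if_neg hn]
    simp [hp]

/-- Integrability is the bilinear bound tested on the unit mass at `0`, whose transform is the
constant `1`. -/
theorem integrable_mul_latticeFourier {m : UnitAddTorus (Fin d) → ℂ}
    (hm : AEStronglyMeasurable m (torusMeasure d)) {f : LatticeLp d 2} {p' : ℝ} (hp' : 0 < p')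
    {K : ℝ≥0∞} (hK : K ≠ ∞)
    (h : ∀ (g : LatticeLp d 2) (B : ℝ), 0 ≤ B → ∑' n, ‖g n‖ₑ ^ p' ≤ ENNReal.ofReal B ^ p' →
      ∫⁻ ξ, ‖m ξ * latticeFourier f ξ‖ₑ * ‖latticeFourier g ξ‖ₑ ∂torusMeasure d ≤
        K * ENNReal.ofReal B) :
    Integrable (fun ξ => m ξ * latticeFourier f ξ) (torusMeasure d) := by
  refine ⟨hm.mul (Lp.aestronglyMeasurable _), ?_⟩
  have h1 := h (latticeFinite {0} 1) 1 zero_le_one (by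
    rw [tsum_enorm_latticeFinite_rpow _ _ hp']
    simp)
  have h2 : ∀ᵐ ξ ∂torusMeasure d, ‖m ξ * latticeFourier f ξ‖ₑ *
      ‖latticeFourier (latticeFinite {0} 1) ξ‖ₑ = ‖m ξ * latticeFourier f ξ‖ₑ := by
    filter_upwards [latticeFourier_latticeFinite (d := d) {0} 1] with ξ hξ
    rw [hξ]
    simp [UnitAddTorus.mFourier_zero]
  rw [lintegral_congr_ae h2] at h1
  exact h1.trans_lt (ENNReal.mul_lt_top hK.lt_top ENNReal.ofReal_lt_top)

theorem integrable_mFourier_mul {G : UnitAddTorus (Fin d) → ℂ}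
    (hG : Integrable G (torusMeasure d)) (n : Fin d → ℤ) :
    Integrable (fun ξ => UnitAddTorus.mFourier n ξ * G ξ) (torusMeasure d) :=
  hG.bdd_mul (c := 1) (UnitAddTorus.mFourier n).continuous.aestronglyMeasurable
    (.of_forall fun ξ => ((UnitAddTorus.mFourier n).norm_coe_le_norm ξ).trans
      UnitAddTorus.mFourier_norm.le)

theorem LatticeLp.toTwo_add {p : ℝ≥0∞} (hp : p ≤ 2) (f g : LatticeLp d p) :
    (f + g).toTwo hp = f.toTwo hp + g.toTwo hp :=
  lp.ext ((lp.coeFn_add f g).trans (lp.coeFn_add (f.toTwo hp) (g.toTwo hp)).symm)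

theorem LatticeLp.toTwo_smul {p : ℝ≥0∞} (hp : p ≤ 2) (a : ℂ) (f : LatticeLp d p) :
    (a • f).toTwo hp = a • f.toTwo hp :=
  lp.ext ((lp.coeFn_smul a f).trans (lp.coeFn_smul a (f.toTwo hp)).symm)

theorem fourierMultiplier_eq_integral (m : UnitAddTorus (Fin d) → ℂ) (f : LatticeLp d 2)
    (n : Fin d → ℤ) : fourierMultiplier m f n =
      ∫ ξ, UnitAddTorus.mFourier (-n) ξ * (m ξ * latticeFourier f ξ) ∂torusMeasure d := rfl

theorem fourierMultiplier_add {m : UnitAddTorus (Fin d) → ℂ} {f g : LatticeLp d 2}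
    (hf : Integrable (fun ξ => m ξ * latticeFourier f ξ) (torusMeasure d))
    (hg : Integrable (fun ξ => m ξ * latticeFourier g ξ) (torusMeasure d)) (n : Fin d → ℤ) :
    fourierMultiplier m (f + g) n = fourierMultiplier m f n + fourierMultiplier m g n := by
  simp only [fourierMultiplier_eq_integral]
  rw [← integral_add (integrable_mFourier_mul hf (-n)) (integrable_mFourier_mul hg (-n)),
    latticeFourier_add]
  refine integral_congr_ae ?_
  filter_upwards [Lp.coeFn_add (latticeFourier f) (latticeFourier g)] with ξ hξ
  rw [hξ, Pi.add_apply, mul_add, mul_add]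

theorem fourierMultiplier_smul (m : UnitAddTorus (Fin d) → ℂ) (a : ℂ) (f : LatticeLp d 2)
    (n : Fin d → ℤ) : fourierMultiplier m (a • f) n = a * fourierMultiplier m f n := by
  simp only [fourierMultiplier_eq_integral]
  rw [← integral_const_mul, latticeFourier_smul]
  refine integral_congr_ae ?_
  filter_upwards [Lp.coeFn_smul a (latticeFourier f)] with ξ hξ
  rw [hξ, Pi.smul_apply, smul_eq_mul]
  ring

/-- Pairing of Fourier coefficients with a finitely supported function. -/
theorem sum_conj_mul_mFourierCoeff {G : UnitAddTorus (Fin d) → ℂ}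
    (hG : Integrable G (torusMeasure d)) (S : Finset (Fin d → ℤ)) (g : (Fin d → ℤ) → ℂ) :
    ∑ n ∈ S, star (g n) * UnitAddTorus.mFourierCoeff G n =
      ∫ ξ, G ξ * star (latticeFourier (latticeFinite S g) ξ) ∂torusMeasure d := by
  have h2 : ∀ n, star (g n) * UnitAddTorus.mFourierCoeff G n =
      ∫ ξ, star (g n) * (UnitAddTorus.mFourier (-n) ξ * G ξ) ∂torusMeasure d := fun n => by
    rw [integral_const_mul]
    rfl
  simp_rw [h2]
  rw [← integral_finsetSum _ fun n _ => (integrable_mFourier_mul hG (-n)).const_mul _]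
  refine integral_congr_ae ?_
  filter_upwards [latticeFourier_latticeFinite S g] with ξ hξ
  rw [hξ, star_sum, Finset.mul_sum]
  refine Finset.sum_congr rfl fun n _ => ?_
  rw [UnitAddTorus.mFourier_neg, star_mul', ← starRingEnd_apply, ← starRingEnd_apply]
  ring

/-- An `ℓ^q` bound for Fourier coefficients, by duality. -/
theorem sum_norm_mFourierCoeff_rpow_le {G : UnitAddTorus (Fin d) → ℂ}
    (hG : Integrable G (torusMeasure d)) {p' q : ℝ} (hpq : p'.HolderConjugate q) {K : ℝ}
    (hK : 0 ≤ K)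
    (h : ∀ (g : LatticeLp d 2) (B : ℝ), 0 ≤ B → ∑' n, ‖g n‖ₑ ^ p' ≤ ENNReal.ofReal B ^ p' →
      ∫⁻ ξ, ‖G ξ‖ₑ * ‖latticeFourier g ξ‖ₑ ∂torusMeasure d ≤
        ENNReal.ofReal K * ENNReal.ofReal B) (S : Finset (Fin d → ℤ)) :
    ∑ n ∈ S, ‖UnitAddTorus.mFourierCoeff G n‖ ^ q ≤ K ^ q := by
  set u := UnitAddTorus.mFourierCoeff G with hu
  set X := ∑ n ∈ S, ‖u n‖ ^ q with hX
  have hX0 : 0 ≤ X := Finset.sum_nonneg fun n _ => by positivity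
  have hq1 : 1 < q := hpq.symm.lt
  have hq0 : 0 < q := by linarith
  have hp0 : 0 < p' := hpq.pos
  -- The extremiser of Hölder's inequality: `star (g n) * u n` and `‖g n‖ ^ p'` both equal `‖u n‖ ^
  -- q`.
  set g : (Fin d → ℤ) → ℂ := fun n => (‖u n‖ ^ (q - 2) : ℝ) * u n with hg
  have hgnorm : ∀ n, ‖g n‖ = ‖u n‖ ^ (q - 1) := fun n => by
    rcases eq_or_ne (u n) 0 with h0 | h0
    · simp [hg, h0, Real.zero_rpow (sub_pos.2 hq1).ne']
    · have : 0 < ‖u n‖ := norm_pos_iff.2 h0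
      rw [hg, norm_mul, Complex.norm_real, Real.norm_of_nonneg (by positivity)]
      conv_lhs => rw [← Real.rpow_one ‖u n‖, ← Real.rpow_mul this.le, one_mul,
        ← Real.rpow_add this]
      ring_nf
  have hgu : ∀ n, star (g n) * u n = ((‖u n‖ ^ q : ℝ) : ℂ) := fun n => by
    rcases eq_or_ne (u n) 0 with h0 | h0
    · simp [h0, Real.zero_rpow hq0.ne']
    · have : 0 < ‖u n‖ := norm_pos_iff.2 h0
      rw [hg, star_mul', ← starRingEnd_apply, ← starRingEnd_apply, Complex.conj_ofReal, mul_assoc,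
        ← Complex.normSq_eq_conj_mul_self, Complex.normSq_eq_norm_sq, ← Complex.ofReal_mul,
        ← Real.rpow_natCast, ← Real.rpow_add this]
      norm_num
  have hgp : ∀ n, ‖g n‖ ^ p' = ‖u n‖ ^ q := fun n => by
    rw [hgnorm, ← Real.rpow_mul (norm_nonneg _)]
    congr 1
    rw [mul_comm, mul_sub, mul_one, hpq.mul_eq_add]
    ring
  have hsum : ∑' n, ‖latticeFinite S g n‖ₑ ^ p' = ENNReal.ofReal X := by
    rw [tsum_enorm_latticeFinite_rpow _ _ hp0, hX,
      ENNReal.ofReal_sum_of_nonneg fun n _ => by positivity]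
    refine Finset.sum_congr rfl fun n _ => ?_
    rw [← hgp, ← ofReal_norm, ENNReal.ofReal_rpow_of_nonneg (norm_nonneg _) hp0.le]
  have hB : ENNReal.ofReal X = ENNReal.ofReal (X ^ (1 / p')) ^ p' := by
    rw [ENNReal.ofReal_rpow_of_nonneg (by positivity) hp0.le, ← Real.rpow_mul hX0,
      one_div_mul_cancel hp0.ne', Real.rpow_one]
  have key := h (latticeFinite S g) (X ^ (1 / p')) (by positivity) (by rw [hsum, hB])
  have hXle : X ≤ K * X ^ (1 / p') := by
    have e1 : (X : ℂ) = ∫ ξ, G ξ * star (latticeFourier (latticeFinite S g) ξ)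
        ∂torusMeasure d := by
      rw [← sum_conj_mul_mFourierCoeff hG, hX, Complex.ofReal_sum]
      exact Finset.sum_congr rfl fun n _ => (hgu n).symm
    have e2 : ENNReal.ofReal X ≤ ENNReal.ofReal (K * X ^ (1 / p')) := by
      rw [ENNReal.ofReal_mul hK]
      calc ENNReal.ofReal X = ‖(X : ℂ)‖ₑ := by
            rw [← ofReal_norm, Complex.norm_real, Real.norm_of_nonneg hX0]
        _ ≤ _ := by
            rw [e1]
            refine (enorm_integral_le_lintegral_enorm _).trans (le_trans (le_of_eq ?_) key)
            refine lintegral_congr fun ξ => ?_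
            rw [enorm_mul]
            congr 1
            rw [← ofReal_norm, norm_star, ofReal_norm]
    exact (ENNReal.ofReal_le_ofReal_iff (by positivity)).1 e2
  -- From `X ≤ K * X ^ (1 / p')` one divides by `X ^ (1 / p')`, which requires `X > 0`.
  rcases hX0.eq_or_lt with h0 | h0
  · rw [← h0]
    positivity
  have hXq : X ^ (1 / q) ≤ K := by
    have e3 : X ^ (1 / q) * X ^ (1 / p') = X := by
      rw [← Real.rpow_add h0]
      have := hpq.inv_add_inv_eq_one
      rw [one_div, one_div, add_comm, this, Real.rpow_one]
    have e4 : 0 < X ^ (1 / p') := by positivity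
    refine le_of_mul_le_mul_right ?_ e4
    rwa [e3]
  calc X = (X ^ (1 / q)) ^ q := by
        rw [← Real.rpow_mul hX0, one_div_mul_cancel hq0.ne', Real.rpow_one]
    _ ≤ K ^ q := by gcongr

end

/-! ### Boundedness of the multiplier -/

theorem mainTheorem10 (d : ℕ) (r c : ℝ) (hr0 : 0 < r) (hrd : r < d)
    (m : UnitAddTorus (Fin d) → ℂ) (hm : AEStronglyMeasurable m (torusMeasure d))
    (hmc : ∀ ξ : EuclideanSpace ℝ (Fin d), (∀ i, ξ i ∈ Set.Ioo (0 : ℝ) 1) → ξ ≠ 0 →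
      ‖m (fun i => (ξ i : UnitAddCircle))‖ ≤ c * ‖ξ‖ ^ (-r))
    (p q : ℝ≥0∞) [Fact (1 ≤ p)] [Fact (1 ≤ q)]
    (hp1 : 1 < p) (hp2 : p ≤ 2) (hq2 : 2 ≤ q) (hq : q < ∞)
    (hpq : 1 / p.toReal - 1 / q.toReal = r / d) :
    (∀ f : LatticeLp d p,
      Integrable (fun ξ => m ξ * latticeFourier (f.toTwo hp2) ξ) (torusMeasure d)) ∧
    ∃ T : LatticeLp d p →L[ℂ] LatticeLp d q,
      ∀ (f : LatticeLp d p) (n : Fin d → ℤ), T f n = fourierMultiplier m (f.toTwo hp2) n := by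
  have hd : 0 < d := by exact_mod_cast hr0.trans hrd
  have hd' : (0 : ℝ) < d := by exact_mod_cast hd
  have hptop : p ≠ ∞ := ne_top_of_le_ne_top (by norm_num) hp2
  have hp1r : 1 < p.toReal := by
    simpa using (ENNReal.toReal_lt_toReal (by norm_num) hptop).2 hp1
  have hp0r : 0 < p.toReal := by linarith
  have hp2r : p.toReal ≤ 2 := by simpa using ENNReal.toReal_mono (by norm_num) hp2
  have hq2r : 2 ≤ q.toReal := by simpa using ENNReal.toReal_mono hq.ne hq2
  set p' : ℝ := q.toReal.conjExponent with hp'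
  have hconj : q.toReal.HolderConjugate p' := Real.HolderConjugate.conjExponent (by linarith)
  -- This is where `q ≥ 2` enters: the dual exponent lies in the range of the weighted inequality.
  have hp2' : p' ≤ 2 := by
    rw [hp', Real.conjExponent, div_le_iff₀ (by linarith)]
    linarith
  have hr : r = d * (1 / p.toReal + 1 / p' - 1) := by
    have h1 := hconj.inv_add_inv_eq_one
    have h2 : r = d * (1 / p.toReal - 1 / q.toReal) := by
      rw [hpq]
      field_simp
    rw [h2, one_div, one_div, one_div, ← h1]
    ring
  obtain ⟨C, hC, hbound⟩ := lintegral_torusSup_rpow_latticeFourier_mul_le hd hp1r hp2r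
    hconj.symm.lt hp2' hr
  have hmul : ∀ (f : LatticeLp d p) (g : LatticeLp d 2) (B : ℝ), 0 ≤ B →
      ∑' n, ‖g n‖ₑ ^ p' ≤ ENNReal.ofReal B ^ p' →
      ∫⁻ ξ, ‖m ξ * latticeFourier (f.toTwo hp2) ξ‖ₑ * ‖latticeFourier g ξ‖ₑ ∂torusMeasure d ≤
        ENNReal.ofReal (|c| * C.toReal * ‖f‖) * ENNReal.ofReal B := by
    intro f g B hB hg
    have hf : ∑' n, ‖f.toTwo hp2 n‖ₑ ^ p.toReal ≤ ENNReal.ofReal ‖f‖ ^ p.toReal := by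
      rw [ofReal_norm]
      exact (lp_tsum_enorm_rpow hp0r f).le
    calc _ ≤ ∫⁻ ξ, ENNReal.ofReal |c| * (ENNReal.ofReal (torusSup ξ) ^ (-r) *
          ‖latticeFourier (f.toTwo hp2) ξ‖ₑ * ‖latticeFourier g ξ‖ₑ) ∂torusMeasure d := by
          refine lintegral_mono_ae ?_
          filter_upwards [ae_norm_le_torusSup_rpow hr0 hrd hmc] with ξ hξ
          rw [enorm_mul, ← mul_assoc, ← mul_assoc]
          gcongr
          rw [← ofReal_norm, ENNReal.ofReal_rpow_of_pos (torusSup_pos hd ξ),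
            ← ENNReal.ofReal_mul (abs_nonneg c)]
          exact ENNReal.ofReal_le_ofReal hξ
      _ = ENNReal.ofReal |c| * _ := lintegral_const_mul' _ _ ENNReal.ofReal_ne_top
      _ ≤ ENNReal.ofReal |c| * (C * ENNReal.ofReal ‖f‖ * ENNReal.ofReal B) := by
          gcongr
          exact hbound _ g ‖f‖ B (norm_nonneg _) hB hf hg
      _ = _ := by
          rw [ENNReal.ofReal_mul (by positivity), ENNReal.ofReal_mul (by positivity),
            ENNReal.ofReal_toReal hC]
          ring
  have hint : ∀ f : LatticeLp d p,
      Integrable (fun ξ => m ξ * latticeFourier (f.toTwo hp2) ξ) (torusMeasure d) := fun f =>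
    integrable_mul_latticeFourier hm hconj.symm.pos ENNReal.ofReal_ne_top (hmul f)
  refine ⟨hint, ?_⟩
  -- Bounds uniform in the finite set `S` give both membership in `ℓ^q` and the operator norm bound.
  have hsum : ∀ (f : LatticeLp d p) (S : Finset (Fin d → ℤ)),
      ∑ n ∈ S, ‖fourierMultiplier m (f.toTwo hp2) n‖ ^ q.toReal ≤
        (|c| * C.toReal * ‖f‖) ^ q.toReal := fun f S =>
    sum_norm_mFourierCoeff_rpow_le (hint f) hconj.symm (by positivity) (hmul f) S
  let L : LatticeLp d p →ₗ[ℂ] LatticeLp d q :=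
    { toFun := fun f => ⟨fourierMultiplier m (f.toTwo hp2), memℓp_gen' (hsum f)⟩
      map_add' := fun f g => lp.ext (funext fun n => by
        rw [lp.coeFn_add, Pi.add_apply]
        dsimp only
        rw [LatticeLp.toTwo_add]
        exact fourierMultiplier_add (hint f) (hint g) n)
      map_smul' := fun a f => lp.ext (funext fun n => by
        rw [lp.coeFn_smul, Pi.smul_apply]
        dsimp only
        rw [LatticeLp.toTwo_smul]
        exact fourierMultiplier_smul m a (f.toTwo hp2) n) }
  exact ⟨L.mkContinuous (|c| * C.toReal) fun f => lp.norm_le_of_forall_sum_le (by linarith)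
    (by positivity) (hsum f), fun f n => rfl⟩
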